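/- For $d\in\mathbb N$ and $f:\mathbb R^d\to\mathbb R$ let $$U_tf(x)=\mathbb E_{Z\sim\mathcal N(0,I_d)}\Big[f\big(e^{-t}x+(1-e^{-2t})^{1/2}Z\big)\Big],\qquad t\in[0,1],\ x\in\mathbb R^d,$$ be the Ornstein--Uhlenbeck semigroup, and let $\mathrm B^d(R)$ be the closed Euclidean ball of radius $R$ centred at $0$. There is a polynomial $P$ in four variables (universal: independent of $d,L,\varepsilon,R,f$) such that the following holds. For all $d\in\mathbb N$, $L\ge 0$, $\varepsilon>0$ and $R>0$ there is an integer $N\ge 1$, depending only on $(d,L,\varepsilon,R)$, with $N\le P(1/\varepsilon,d,L,R)$, such that for every differentiable $f:\mathbb R^d\to\mathbb R$ for which both $f$ and $\nabla f$ are $L$-Lipschitz there exist points $z_1,\dots,z_N\in\mathbb R^d$ with $$\max_{n\le N}\|z_n\|\le 8\sqrt{(d+6)\log N},$$ $$\sup_{x\in\mathrm B^d(R)}\ \sup_{t\in[0,1]}\Big|\frac1N\sum_{n=1}^N f\big(e^{-t}x+(1-e^{-2t})^{1/2}z_n\big)-U_tf(x)\Big|\le\varepsilon,$$ $$\sup_{x\in\mathrm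 B^d(R)}\ \sup_{t\in[0,1]}\Big\|\frac1N\sum_{n=1}^N \nabla_x\Big[f\big(e^{-t}x+(1-e^{-2t})^{1/2}z_n\big)\Big]-\nabla U_tf(x)\Big\|\le\varepsilon .$$ Here the expectation defining $U_tf(x)$ exists and $U_tf$ is differentiable at every $x\in\mathrm B^d(R)$, $t\in[0,1]$; $\nabla_x$ is the gradient of the composed function of $x$. -/

import Mathlib

open MeasureTheory ProbabilityTheory

/-- The point `e^{-t} x + (1 - e^{-2t})^{1/2} z`. -/
noncomputable def ouPoint {d : ℕ} (t : ℝ) (x z : EuclideanSpace ℝ (Fin d)) :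
    EuclideanSpace ℝ (Fin d) :=
  Real.exp (-t) • x + Real.sqrt (1 - Real.exp (-2 * t)) • z

/-- The Ornstein-Uhlenbeck semigroup
`U_t f(x) = E_{Z ∼ N(0, I)} [f (e^{-t} x + (1 - e^{-2t})^{1/2} Z)]`. -/
noncomputable def ouSemigroup {d : ℕ} (t : ℝ) (f : EuclideanSpace ℝ (Fin d) → ℝ)
    (x : EuclideanSpace ℝ (Fin d)) : ℝ :=
  ∫ z, f (ouPoint t x z) ∂(stdGaussian (EuclideanSpace ℝ (Fin d)))

/-! The gradient of $U_tf$ is $e^{-t}$ times a Gaussian average of $\nabla f$, so all the claims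
concern averages of $d+1$ Lipschitz functions $h$ ($f$ and its partial derivatives) along $y+sZ$,
with $\|y\|\le R$ and $s\in[0,1]$. Truncating $Z$ at radius $K$ makes each $h(y+sZ)$ bounded, hence
sub-Gaussian by Hoeffding. A Chernoff and union bound over a grid of $N^{d+1}$ pairs $(y,s)$ yields
one good sample (`exists_sample_abs_average_le`), and the Lipschitz property extends it to every
$(y,s)$ (`exists_sample_uniform_gaussian_average`). The union bound costs only about $(d+2)\log N$
and the Gaussian tail beyond $K$ decays like a power of $N$, so a polynomial $N$ suffices
(`sample_size_bounds`). -/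

/-! ### Existence of good samples -/

/-- Derandomised Chernoff bound: some sample does at least as well as a random one on the
exponential potential of a weighted finite family of sub-Gaussian variables. -/
lemma exists_sample_sum_exp_le {Ω ι : Type*} [MeasurableSpace Ω] {μ : Measure Ω}
    [IsProbabilityMeasure μ] [Fintype ι] {X : ι → Ω → ℝ} {c : NNReal}
    (hX : ∀ j, HasSubgaussianMGF (X j) c μ) (l : ℝ) (N : ℕ) (w : ι → ℝ) (hw : ∀ j, 0 ≤ w j) :
    ∃ z : Fin N → Ω, ∑ j, w j * Real.exp (l * ∑ n, X j (z n)) ≤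
      (∑ j, w j) * Real.exp (N * (c * l ^ 2 / 2)) := by
  induction N generalizing w with
  | zero => exact ⟨Fin.elim0, by simp⟩
  | succ N ih =>
    have hint : ∀ j, Integrable (fun ω => w j * Real.exp (l * X j ω)) μ :=
      fun j => ((hX j).integrable_exp_mul l).const_mul _
    obtain ⟨ω, hω⟩ := exists_le_integral (integrable_finsetSum Finset.univ fun j _ => hint j)
    have hω' : ∑ j, w j * Real.exp (l * X j ω) ≤ (∑ j, w j) * Real.exp (c * l ^ 2 / 2) := by
      refine hω.trans ?_
      rw [integral_finsetSum _ fun j _ => hint j, Finset.sum_mul]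
      refine Finset.sum_le_sum fun j _ => ?_
      rw [integral_const_mul]
      exact mul_le_mul_of_nonneg_left ((hX j).mgf_le l) (hw j)
    -- The exponentials of the point already chosen are absorbed into the weights; this is why the
    -- induction runs over all `w`.
    obtain ⟨z, hz⟩ := ih (fun j => w j * Real.exp (l * X j ω))
      fun j => mul_nonneg (hw j) (Real.exp_pos _).le
    refine ⟨Fin.cons ω z, ?_⟩
    calc ∑ j, w j * Real.exp (l * ∑ n, X j ((Fin.cons ω z : Fin (N + 1) → Ω) n))
        = ∑ j, w j * Real.exp (l * X j ω) * Real.exp (l * ∑ n, X j (z n)) := by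
          refine Finset.sum_congr rfl fun j _ => ?_
          rw [Fin.sum_univ_succ, mul_add, Real.exp_add, mul_assoc]
          simp
      _ ≤ _ := hz
      _ ≤ (∑ j, w j) * Real.exp (c * l ^ 2 / 2) * Real.exp (N * (c * l ^ 2 / 2)) := by gcongr
      _ = _ := by
          rw [mul_assoc, ← Real.exp_add]
          congr 2
          push_cast
          ring

/-- A finite family of sub-Gaussian variables admits a sample of logarithmic size whose empirical
averages are simultaneously small. -/
lemma exists_sample_abs_average_le {Ω ι : Type*} [MeasurableSpace Ω] {μ : Measure Ω}
    [IsProbabilityMeasure μ] [Fintype ι] {X : ι → Ω → ℝ} {c : NNReal} (hc : 0 < c)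
    (hX : ∀ j, HasSubgaussianMGF (X j) c μ) {η : ℝ} (hη : 0 < η) {N : ℕ} (hN : 1 ≤ N)
    (h : 2 * c * Real.log (2 * Fintype.card ι) ≤ N * η ^ 2) :
    ∃ z : Fin N → Ω, ∀ j, |1 / (N : ℝ) * ∑ n, X j (z n)| ≤ η := by
  have hc' : (0 : ℝ) < c := by exact_mod_cast hc
  have hN' : (0 : ℝ) < N := by exact_mod_cast hN
  -- The sum type handles both signs at once; `η / c` is the optimal Chernoff parameter.
  obtain ⟨z, hz⟩ := exists_sample_sum_exp_le (μ := μ) (X := Sum.elim X fun j => -X j) (c := c)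
    (by rintro (j | j); exacts [hX j, (hX j).neg]) (η / c) N (fun _ => 1) (fun _ => zero_le_one)
  have hcard : (∑ _j : ι ⊕ ι, (1 : ℝ)) = 2 * Fintype.card ι := by simp; ring
  rw [hcard] at hz
  have key : ∀ j : ι ⊕ ι, ∑ n, (Sum.elim X (fun j => -X j) j) (z n) ≤ N * η := by
    intro j
    have h1 := (Finset.single_le_sum (f := fun j : ι ⊕ ι =>
      1 * Real.exp (η / c * ∑ n, (Sum.elim X (fun j => -X j) j) (z n)))
      (fun _ _ => by positivity) (Finset.mem_univ j)).trans hz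
    have hpos : (0 : ℝ) < 2 * Fintype.card ι := by
      by_contra hneg
      have : (2 * Fintype.card ι : ℝ) = 0 := le_antisymm (not_lt.1 hneg) (by positivity)
      rw [this, zero_mul] at h1
      exact absurd h1 (not_le.2 (by positivity))
    simp only [one_mul] at h1
    rw [← Real.exp_log hpos, ← Real.exp_add, Real.exp_le_exp] at h1
    have h2 : Real.log (2 * Fintype.card ι) ≤ N * η ^ 2 / (2 * c) := by
      rw [le_div_iff₀ (by positivity)]; linarith
    have h3 : η / c * ∑ n, (Sum.elim X (fun j => -X j) j) (z n) ≤ η / c * (N * η) := by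
      refine h1.trans ((add_le_add_left h2 _).trans (le_of_eq ?_))
      field_simp
      ring
    exact le_of_mul_le_mul_left h3 (by positivity)
  refine ⟨z, fun j => ?_⟩
  have h1 := key (Sum.inl j)
  have h2 := key (Sum.inr j)
  simp only [Sum.elim_inl, Sum.elim_inr, Pi.neg_apply, Finset.sum_neg_distrib] at h1 h2
  rw [abs_mul, abs_of_pos (by positivity : (0 : ℝ) < 1 / N), one_div, inv_mul_le_iff₀ hN', abs_le]
  constructor <;> linarith

/-! ### Gaussian exponential moments and truncation -/

lemma integral_exp_sq_div_four_gaussianReal :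
    ∫ x, Real.exp (x ^ 2 / 4) ∂(gaussianReal 0 1) = Real.sqrt 2 := by
  rw [integral_gaussianReal_eq_integral_smul one_ne_zero]
  have h : ∀ x : ℝ, gaussianPDFReal 0 1 x • Real.exp (x ^ 2 / 4) =
      (Real.sqrt (2 * Real.pi))⁻¹ * Real.exp (-(1 / 4) * x ^ 2) := by
    intro x
    rw [gaussianPDFReal_def, smul_eq_mul]
    simp only [NNReal.coe_one, mul_one, sub_zero]
    rw [mul_assoc, ← Real.exp_add]
    congr 2
    ring
  simp_rw [h]
  rw [integral_const_mul, integral_gaussian, inv_mul_eq_div, ← Real.sqrt_div (by positivity)]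
  congr 1
  field_simp
  norm_num

lemma integrable_exp_sq_div_four_gaussianReal :
    Integrable (fun x : ℝ => Real.exp (x ^ 2 / 4)) (gaussianReal 0 1) := by
  by_contra h
  -- A non-integrable function would have integral 0, not `√2`.
  have := integral_undef h
  rw [integral_exp_sq_div_four_gaussianReal] at this
  simp at this

lemma exp_norm_sq_div_four_eq_prod {d : ℕ} (x : Fin d → ℝ) :
    Real.exp (‖(WithLp.toLp 2 x : EuclideanSpace ℝ (Fin d))‖ ^ 2 / 4) =
      ∏ i, Real.exp (x i ^ 2 / 4) := by
  rw [EuclideanSpace.norm_sq_eq, Finset.sum_div, Real.exp_sum]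
  simp

lemma integrable_exp_norm_sq_div_four_stdGaussian (d : ℕ) :
    Integrable (fun z => Real.exp (‖z‖ ^ 2 / 4)) (stdGaussian (EuclideanSpace ℝ (Fin d))) := by
  rw [← map_pi_eq_stdGaussian, integrable_map_measure
    (Continuous.aestronglyMeasurable (by fun_prop)) (Measurable.aemeasurable (by fun_prop))]
  simp only [Function.comp_def, exp_norm_sq_div_four_eq_prod]
  exact Integrable.fintype_prod fun _ => integrable_exp_sq_div_four_gaussianReal

lemma integral_exp_norm_sq_div_four_stdGaussian (d : ℕ) :
    ∫ z, Real.exp (‖z‖ ^ 2 / 4) ∂(stdGaussian (EuclideanSpace ℝ (Fin d))) = Real.sqrt 2 ^ d := by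
  rw [← map_pi_eq_stdGaussian, integral_map (Measurable.aemeasurable (by fun_prop))
    (Continuous.aestronglyMeasurable (by fun_prop))]
  simp only [exp_norm_sq_div_four_eq_prod]
  rw [integral_fintype_prod_eq_prod (fun (_ : Fin d) x => Real.exp (x ^ 2 / 4))]
  simp [integral_exp_sq_div_four_gaussianReal]

/-- Truncation to the closed ball of radius `K`. -/
noncomputable def truncBall {E : Type*} [NormedAddCommGroup E] (K : ℝ) (z : E) : E :=
  open Classical in if ‖z‖ ≤ K then z else 0

lemma norm_truncBall_le {E : Type*} [NormedAddCommGroup E] {K : ℝ} (hK : 0 ≤ K) (z : E) :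
    ‖truncBall K z‖ ≤ K := by
  unfold truncBall
  split_ifs with h
  · exact h
  · simpa using hK

lemma measurable_truncBall {E : Type*} [NormedAddCommGroup E] [MeasurableSpace E] [BorelSpace E]
    (K : ℝ) : Measurable (truncBall K : E → E) := by
  classical
  unfold truncBall
  exact Measurable.ite (measurableSet_le measurable_norm measurable_const) measurable_id
    measurable_const

/-- Outside the ball, half of the exponent `‖z‖ ^ 2 / 4` dominates `‖z‖` and the other half is at
least `K ^ 2 / 8`. -/
lemma norm_sub_truncBall_le {E : Type*} [NormedAddCommGroup E] {K : ℝ} (hK : 0 ≤ K) (z : E) :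
    ‖z - truncBall K z‖ ≤ 4 * Real.exp (-(K ^ 2 / 8)) * Real.exp (‖z‖ ^ 2 / 4) := by
  unfold truncBall
  split_ifs with h
  · simp; positivity
  · rw [sub_zero]
    have h1 : ‖z‖ ≤ 4 * Real.exp (‖z‖ ^ 2 / 8) := by
      nlinarith [Real.add_one_le_exp (‖z‖ ^ 2 / 8), sq_nonneg (‖z‖ - 1)]
    have h2 : ‖z‖ ^ 2 / 8 ≤ -(K ^ 2 / 8) + ‖z‖ ^ 2 / 4 := by nlinarith [not_le.1 h]
    rw [mul_assoc, ← Real.exp_add]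
    exact h1.trans (by gcongr)

lemma integral_norm_sub_truncBall_le (d : ℕ) {K : ℝ} (hK : 0 ≤ K) :
    ∫ z, ‖z - truncBall K z‖ ∂(stdGaussian (EuclideanSpace ℝ (Fin d))) ≤
      4 * Real.exp (-(K ^ 2 / 8)) * Real.sqrt 2 ^ d := by
  rw [← integral_exp_norm_sq_div_four_stdGaussian, ← integral_const_mul]
  refine integral_mono_of_nonneg (Filter.Eventually.of_forall fun _ => norm_nonneg _)
    ((integrable_exp_norm_sq_div_four_stdGaussian d).const_mul _)
    (Filter.Eventually.of_forall fun z => norm_sub_truncBall_le hK z)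

lemma integrable_norm_stdGaussian (d : ℕ) :
    Integrable (fun z => ‖z‖) (stdGaussian (EuclideanSpace ℝ (Fin d))) :=
  (IsGaussian.integrable_id (μ := stdGaussian (EuclideanSpace ℝ (Fin d)))).norm

/-! ### Grids for scales and centres -/

lemma exists_fin_abs_sub_div_le {N : ℕ} (hN : 1 ≤ N) {u : ℝ} (h0 : 0 ≤ u) (h1 : u ≤ 1) :
    ∃ j : Fin N, |u - (j : ℝ) / N| ≤ 1 / N := by
  have hN' : (0 : ℝ) < N := by exact_mod_cast hN
  rcases h1.lt_or_eq with h | rfl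
  · have hf := Nat.floor_le (show 0 ≤ u * N by positivity)
    have hf' := Nat.lt_floor_add_one (u * N)
    refine ⟨⟨⌊u * N⌋₊, (Nat.floor_lt (by positivity)).2 (by nlinarith)⟩, ?_⟩
    rw [abs_le]
    constructor
    · have : (⌊u * N⌋₊ : ℝ) / N ≤ u := (div_le_iff₀ hN').2 hf
      have : (0 : ℝ) ≤ 1 / N := by positivity
      simp only
      linarith
    · have : u ≤ (⌊u * N⌋₊ + 1 : ℝ) / N := (le_div_iff₀ hN').2 hf'.le
      rw [add_div] at this
      simp only
      linarith
  -- The grid stops at `(N - 1) / N`, so the endpoint 1 is exactly one mesh away.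
  · refine ⟨⟨N - 1, by omega⟩, le_of_eq ?_⟩
    simp only
    rw [Nat.cast_sub hN, sub_div, div_self hN'.ne', Nat.cast_one, sub_sub_cancel,
      abs_of_pos (by positivity)]

/-- A point of the lattice of mesh `2 R / N` in the cube `[-R, R]^d`. -/
noncomputable def cubeGrid {d : ℕ} (R : ℝ) {N : ℕ} (k : Fin d → Fin N) :
    EuclideanSpace ℝ (Fin d) :=
  WithLp.toLp 2 fun i => R * (2 * ((k i : ℝ) / N) - 1)

lemma EuclideanSpace.norm_le_sum_abs {d : ℕ} (v : EuclideanSpace ℝ (Fin d)) :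
    ‖v‖ ≤ ∑ i, |v i| := by
  rw [EuclideanSpace.norm_eq]
  refine Real.sqrt_le_iff.2 ⟨by positivity, ?_⟩
  simp only [Real.norm_eq_abs]
  exact Finset.sum_sq_le_sq_sum_of_nonneg fun i _ => abs_nonneg _

lemma exists_norm_sub_cubeGrid_le {d : ℕ} {R : ℝ} (hR : 0 < R) {N : ℕ} (hN : 1 ≤ N)
    {y : EuclideanSpace ℝ (Fin d)} (hy : ‖y‖ ≤ R) :
    ∃ k : Fin d → Fin N, ‖y - cubeGrid R k‖ ≤ d * (2 * R / N) := by
  have h : ∀ i, ∃ j : Fin N, |y i - R * (2 * ((j : ℝ) / N) - 1)| ≤ 2 * R / N := by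
    intro i
    have hi : |y i| ≤ R := (PiLp.norm_apply_le y i).trans hy
    rw [abs_le] at hi
    obtain ⟨j, hj⟩ := exists_fin_abs_sub_div_le hN (u := (y i + R) / (2 * R))
      (div_nonneg (by linarith) (by linarith)) ((div_le_one (by linarith)).2 (by linarith))
    refine ⟨j, ?_⟩
    have : y i - R * (2 * ((j : ℝ) / N) - 1) = 2 * R * ((y i + R) / (2 * R) - (j : ℝ) / N) := by
      field_simp
      ring
    rw [this, abs_mul, abs_of_pos (by linarith : 0 < 2 * R), ← mul_one_div (2 * R)]
    gcongr
  choose k hk using h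
  refine ⟨k, (EuclideanSpace.norm_le_sum_abs _).trans ?_⟩
  refine (Finset.sum_le_sum (g := fun _ => 2 * R / N) fun i _ => ?_).trans (by simp)
  simpa [cubeGrid] using hk i

/-! ### Uniform empirical approximation of Gaussian averages -/

/-- The error of the empirical average of a sample changes by at most `2 δ` when the integrand is
perturbed uniformly by `δ`. -/
lemma abs_average_sub_integral_sub_le {Ω : Type*} [MeasurableSpace Ω] {μ : Measure Ω}
    [IsProbabilityMeasure μ] {g g' : Ω → ℝ} (hg : Integrable g μ) (hg' : Integrable g' μ) {δ : ℝ}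
    (h : ∀ ω, |g ω - g' ω| ≤ δ) {N : ℕ} (hN : 1 ≤ N) (z : Fin N → Ω) :
    |1 / (N : ℝ) * ∑ n, g (z n) - ∫ ω, g ω ∂μ| ≤
      |1 / (N : ℝ) * ∑ n, g' (z n) - ∫ ω, g' ω ∂μ| + 2 * δ := by
  have hN' : (0 : ℝ) < N := by exact_mod_cast hN
  have h1 : |1 / (N : ℝ) * ∑ n, g (z n) - 1 / (N : ℝ) * ∑ n, g' (z n)| ≤ δ := by
    rw [← mul_sub, ← Finset.sum_sub_distrib, abs_mul, abs_of_pos (by positivity : (0 : ℝ) < 1 / N),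
      one_div, inv_mul_le_iff₀ hN']
    refine (Finset.abs_sum_le_sum_abs _ _).trans ?_
    refine (Finset.sum_le_sum fun n _ => h (z n)).trans (by simp)
  have h2 : |∫ ω, g ω ∂μ - ∫ ω, g' ω ∂μ| ≤ δ := by
    rw [← integral_sub hg hg']
    simpa using norm_integral_le_of_norm_le_const (μ := μ) (f := fun ω => g ω - g' ω) (C := δ)
      (Filter.Eventually.of_forall h)
  rw [abs_le] at h1 h2
  have h3 := neg_abs_le (1 / (N : ℝ) * ∑ n, g' (z n) - ∫ ω, g' ω ∂μ)
  have h4 := le_abs_self (1 / (N : ℝ) * ∑ n, g' (z n) - ∫ ω, g' ω ∂μ)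
  rw [abs_le]
  constructor <;> linarith

lemma LipschitzWith.integrable_comp_add_smul_stdGaussian {d : ℕ} {L : NNReal}
    {F : Type*} [NormedAddCommGroup F] [SecondCountableTopology F]
    {h : EuclideanSpace ℝ (Fin d) → F} (hh : LipschitzWith L h)
    (y : EuclideanSpace ℝ (Fin d)) (s : ℝ) :
    Integrable (fun z => h (y + s • z)) (stdGaussian (EuclideanSpace ℝ (Fin d))) := by
  have hcont : Continuous fun z => h (y + s • z) := hh.continuous.comp (by fun_prop)
  refine Integrable.mono' (g := fun z => ‖h y‖ + L * (|s| * ‖z‖))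
    ((integrable_const _).add (((integrable_norm_stdGaussian d).const_mul _).const_mul _))
    hcont.aestronglyMeasurable (Filter.Eventually.of_forall fun z => ?_)
  have h1 := hh.dist_le_mul (y + s • z) y
  rw [dist_eq_norm, dist_eq_norm, add_sub_cancel_left, norm_smul, Real.norm_eq_abs] at h1
  have h2 := norm_sub_norm_le (h (y + s • z)) (h y)
  linarith

lemma LipschitzWith.abs_sub_le_mul_norm {E : Type*} [NormedAddCommGroup E] {L : NNReal}
    {h : E → ℝ} (hh : LipschitzWith L h) (a b : E) : |h a - h b| ≤ L * ‖a - b‖ := by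
  have := hh.dist_le_mul a b
  rwa [Real.dist_eq, dist_eq_norm] at this

/-- Uniform approximation of the Gaussian averages of finitely many Lipschitz functions, over all
centres in a ball and all scales in `[0, 1]`, by the empirical averages of one sample. -/
lemma exists_sample_uniform_gaussian_average {d : ℕ} {κ : Type*} [Fintype κ] {L : NNReal}
    (hL : 0 < L) {h : κ → EuclideanSpace ℝ (Fin d) → ℝ} (hh : ∀ i, LipschitzWith L (h i))
    {R K η : ℝ} (hR : 0 < R) (hK : 0 < K) (hη : 0 < η) {N : ℕ} (hN : 1 ≤ N)
    (hlog : 2 * (L * K) ^ 2 * Real.log (2 * (Fintype.card κ * N ^ (d + 1) : ℕ)) ≤ N * η ^ 2) :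
    ∃ z : Fin N → EuclideanSpace ℝ (Fin d), (∀ n, ‖z n‖ ≤ K) ∧
      ∀ i, ∀ y, ‖y‖ ≤ R → ∀ s ∈ Set.Icc (0 : ℝ) 1,
        |1 / (N : ℝ) * ∑ n, h i (y + s • z n) -
            ∫ w, h i (y + s • w) ∂(stdGaussian (EuclideanSpace ℝ (Fin d)))| ≤
          η + 2 * (L * (d * (2 * R / N) + K / N)) +
            L * ∫ w, ‖w - truncBall K w‖ ∂(stdGaussian (EuclideanSpace ℝ (Fin d))) := by
  set γ := stdGaussian (EuclideanSpace ℝ (Fin d)) with hγ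
  have hN' : (0 : ℝ) < N := by exact_mod_cast hN
  have hL' : (0 : ℝ) < L := by exact_mod_cast hL
  have htr := measurable_truncBall (E := EuclideanSpace ℝ (Fin d)) K
  have hmeas : ∀ i y (s : ℝ), Measurable fun w => h i (y + s • truncBall K w) := fun i y s =>
    (hh i).continuous.measurable.comp ((htr.const_smul s).const_add y)
  have hbd : ∀ i y, ∀ s ∈ Set.Icc (0 : ℝ) 1, ∀ w,
      |h i (y + s • truncBall K w) - h i y| ≤ L * K := by
    intro i y s hs w
    refine ((hh i).abs_sub_le_mul_norm _ _).trans ?_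
    rw [add_sub_cancel_left, norm_smul, Real.norm_of_nonneg hs.1]
    have := norm_truncBall_le hK.le w
    gcongr
    nlinarith [hs.2, norm_nonneg (truncBall K w)]
  have hint : ∀ i y, ∀ s ∈ Set.Icc (0 : ℝ) 1,
      Integrable (fun w => h i (y + s • truncBall K w)) γ := by
    intro i y s hs
    refine Integrable.mono' (g := fun _ => |h i y| + L * K) (integrable_const _)
      (hmeas i y s).aestronglyMeasurable (Filter.Eventually.of_forall fun w => ?_)
    have h1 := hbd i y s hs w
    have h2 := abs_sub_abs_le_abs_sub (h i (y + s • truncBall K w)) (h i y)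
    rw [Real.norm_eq_abs]
    linarith
  have hgrid : ∀ k : Fin N, ((k : ℝ) / N) ∈ Set.Icc (0 : ℝ) 1 := fun k =>
    ⟨by positivity, (div_le_one hN').2 (by exact_mod_cast k.2.le)⟩
  -- Coordinate 0 of the grid index encodes the scale, the remaining `d` the centre.
  let X : κ × (Fin (d + 1) → Fin N) → EuclideanSpace ℝ (Fin d) → ℝ := fun j w =>
    h j.1 (cubeGrid R (Fin.tail j.2) + ((j.2 0 : ℝ) / N) • truncBall K w) -
      ∫ w, h j.1 (cubeGrid R (Fin.tail j.2) + ((j.2 0 : ℝ) / N) • truncBall K w) ∂γ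
  have hX : ∀ j, HasSubgaussianMGF (X j) ((L * K.toNNReal) ^ 2) γ := by
    intro j
    set y := cubeGrid R (Fin.tail j.2)
    set b := h j.1 y
    -- Hoeffding's lemma: an interval of length `2 * L * K` gives variance proxy `(L * K) ^ 2`.
    have h1 := hasSubgaussianMGF_of_mem_Icc (μ := γ) (a := b - L * K) (b := b + L * K)
      (hmeas j.1 y ((j.2 0 : ℝ) / N)).aemeasurable (Filter.Eventually.of_forall fun w => by
        have := abs_le.1 (hbd j.1 y _ (hgrid (j.2 0)) w)
        constructor <;> simp only [b] <;> linarith)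
    convert h1 using 2
    apply NNReal.eq
    rw [NNReal.coe_mul, NNReal.coe_div, coe_nnnorm, Real.coe_toNNReal _ hK.le,
      Real.norm_of_nonneg (by nlinarith)]
    simp
  obtain ⟨z, hz⟩ := exists_sample_abs_average_le (by positivity) hX hη hN (by
    refine le_trans (le_of_eq ?_) hlog
    rw [NNReal.coe_pow, NNReal.coe_mul, Real.coe_toNNReal _ hK.le]
    simp)
  -- Returning the truncated points makes the norm bound automatic.
  refine ⟨fun n => truncBall K (z n), fun n => norm_truncBall_le hK.le _, ?_⟩
  intro i y hy s hs
  obtain ⟨k, hk⟩ := exists_norm_sub_cubeGrid_le hR hN hy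
  obtain ⟨l, hl⟩ := exists_fin_abs_sub_div_le hN hs.1 hs.2
  have hstab := abs_average_sub_integral_sub_le (hint i y s hs)
    (hint i (cubeGrid R k) _ (hgrid l)) (δ := L * (d * (2 * R / N) + K / N)) (fun w => by
      refine ((hh i).abs_sub_le_mul_norm _ _).trans ?_
      gcongr
      have : y + s • truncBall K w - (cubeGrid R k + ((l : ℝ) / N) • truncBall K w) =
          (y - cubeGrid R k) + (s - (l : ℝ) / N) • truncBall K w := by module
      rw [this]
      refine (norm_add_le _ _).trans (add_le_add hk ?_)
      rw [norm_smul, Real.norm_eq_abs, ← one_div_mul_eq_div (N : ℝ) K]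
      exact mul_le_mul hl (norm_truncBall_le hK.le w) (norm_nonneg _) (by positivity)) hN z
  have hsample : |1 / (N : ℝ) * ∑ n, h i (cubeGrid R k + ((l : ℝ) / N) • truncBall K (z n)) -
      ∫ w, h i (cubeGrid R k + ((l : ℝ) / N) • truncBall K w) ∂γ| ≤ η := by
    have := hz (i, Fin.cons l k)
    simp only [X, Fin.tail_cons, Fin.cons_zero, Finset.sum_sub_distrib, mul_sub] at this
    simpa [hN'.ne'] using this
  have htail : |∫ w, h i (y + s • truncBall K w) ∂γ - ∫ w, h i (y + s • w) ∂γ| ≤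
      L * ∫ w, ‖w - truncBall K w‖ ∂γ := by
    have hdiff : Integrable (fun w => ‖w - truncBall K w‖) γ :=
      Integrable.mono' ((integrable_exp_norm_sq_div_four_stdGaussian d).const_mul
        (4 * Real.exp (-(K ^ 2 / 8)))) (measurable_id.sub htr).norm.aestronglyMeasurable
        (Filter.Eventually.of_forall fun w => by
          rw [norm_norm]; exact norm_sub_truncBall_le hK.le w)
    rw [← integral_sub (hint i y s hs) ((hh i).integrable_comp_add_smul_stdGaussian y s),
      ← integral_const_mul, ← Real.norm_eq_abs]
    refine norm_integral_le_of_norm_le (hdiff.const_mul _)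
      (Filter.Eventually.of_forall fun w => ?_)
    rw [Real.norm_eq_abs]
    refine ((hh i).abs_sub_le_mul_norm _ _).trans ?_
    rw [add_sub_add_left_eq_sub, ← smul_sub, norm_smul, Real.norm_of_nonneg hs.1, norm_sub_rev]
    gcongr
    exact mul_le_of_le_one_left (norm_nonneg _) hs.2
  have := abs_sub_le (1 / (N : ℝ) * ∑ n, h i (y + s • truncBall K (z n)))
    (∫ w, h i (y + s • truncBall K w) ∂γ) (∫ w, h i (y + s • w) ∂γ)
  linarith

/-! ### Differentiation of the semigroup -/

lemma hasFDerivAt_comp_ouPoint {d : ℕ} {f : EuclideanSpace ℝ (Fin d) → ℝ}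
    (hf : Differentiable ℝ f) (t : ℝ) (x z : EuclideanSpace ℝ (Fin d)) :
    HasFDerivAt (fun y => f (ouPoint t y z))
      (innerSL ℝ (Real.exp (-t) • gradient f (ouPoint t x z))) x := by
  have h1 : HasFDerivAt (fun y => ouPoint t y z)
      (Real.exp (-t) • ContinuousLinearMap.id ℝ (EuclideanSpace ℝ (Fin d))) x :=
    ((hasFDerivAt_id x).const_smul (Real.exp (-t))).add_const _
  have h2 := (hf (ouPoint t x z)).hasFDerivAt.comp x h1
  have h3 : (fderiv ℝ f (ouPoint t x z)).comp
      (Real.exp (-t) • ContinuousLinearMap.id ℝ (EuclideanSpace ℝ (Fin d))) =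
      innerSL ℝ (Real.exp (-t) • gradient f (ouPoint t x z)) := by
    ext v
    simp [← inner_gradient_left]
  rw [h3] at h2
  exact h2

lemma gradient_comp_ouPoint {d : ℕ} {f : EuclideanSpace ℝ (Fin d) → ℝ}
    (hf : Differentiable ℝ f) (t : ℝ) (x z : EuclideanSpace ℝ (Fin d)) :
    gradient (fun y => f (ouPoint t y z)) x = Real.exp (-t) • gradient f (ouPoint t x z) :=
  HasGradientAt.gradient (hasFDerivAt_comp_ouPoint hf t x z)

lemma LipschitzWith.norm_gradient_le {d : ℕ} {f : EuclideanSpace ℝ (Fin d) → ℝ} {L : NNReal}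
    (hf : LipschitzWith L f) (x : EuclideanSpace ℝ (Fin d)) : ‖gradient f x‖ ≤ L := by
  rw [gradient, LinearIsometryEquiv.norm_map]
  exact norm_fderiv_le_of_lipschitz ℝ hf

/-- Differentiation under the integral, dominated by the constant `Real.exp (-t) * L` because `f` is
`L`-Lipschitz. -/
lemma hasGradientAt_ouSemigroup {d : ℕ} {f : EuclideanSpace ℝ (Fin d) → ℝ} {L : NNReal}
    (hd : Differentiable ℝ f) (hf : LipschitzWith L f) (hg : LipschitzWith L (gradient f))
    (t : ℝ) (x : EuclideanSpace ℝ (Fin d)) :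
    HasGradientAt (ouSemigroup t f)
      (Real.exp (-t) • ∫ w, gradient f (ouPoint t x w)
        ∂(stdGaussian (EuclideanSpace ℝ (Fin d)))) x := by
  have hint : Integrable (fun w => gradient f (ouPoint t x w))
      (stdGaussian (EuclideanSpace ℝ (Fin d))) := hg.integrable_comp_add_smul_stdGaussian _ _
  have hcomm := (innerSL ℝ : EuclideanSpace ℝ (Fin d) →L[ℝ] _).integral_comp_comm
    (hint.smul (Real.exp (-t)))
  have key := hasFDerivAt_integral_of_dominated_of_fderiv_le
    (μ := stdGaussian (EuclideanSpace ℝ (Fin d))) (F := fun y w => f (ouPoint t y w))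
    (F' := fun y w => innerSL ℝ (Real.exp (-t) • gradient f (ouPoint t y w)))
    (bound := fun _ => Real.exp (-t) * L) (x₀ := x) Filter.univ_mem
    (Filter.Eventually.of_forall fun y =>
      (hf.integrable_comp_add_smul_stdGaussian _ _).aestronglyMeasurable)
    (hf.integrable_comp_add_smul_stdGaussian _ _)
    ((innerSL ℝ).integrable_comp (hint.smul (Real.exp (-t)))).aestronglyMeasurable
    (Filter.Eventually.of_forall fun w y _ => by
      rw [innerSL_apply_norm, norm_smul, Real.norm_of_nonneg (Real.exp_pos _).le]
      gcongr
      exact hf.norm_gradient_le _)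
    (integrable_const _)
    (Filter.Eventually.of_forall fun w y _ => hasFDerivAt_comp_ouPoint hd t y w)
  simp only [Pi.smul_apply] at hcomm
  rw [hcomm, integral_smul] at key
  exact key

lemma LipschitzWith.apply_euclideanSpace {d : ℕ} {α : Type*} [PseudoEMetricSpace α]
    {g : α → EuclideanSpace ℝ (Fin d)} {L : NNReal} (hg : LipschitzWith L g) (i : Fin d) :
    LipschitzWith L fun x => g x i := by
  simpa [Function.comp_def] using (LipschitzWith.eval (α := fun _ : Fin d => ℝ) i).comp
    ((PiLp.lipschitzWith_ofLp 2 fun _ : Fin d => ℝ).comp hg)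

/-! ### Choice of the sample size and conclusion -/

/-- A sample size that is polynomially large in all parameters meets the requirements of
`exists_sample_uniform_gaussian_average` at truncation radius `8 √((d + 6) log N)`. -/
lemma sample_size_bounds {d n N : ℕ} {Λ R η K : ℝ} (hΛ : 1 ≤ Λ) (hR : 0 < R) (hη : 0 < η)
    (hn : 2 * (d + 1) ≤ n) (hB : Λ * (4 * R + 64) * (d + 6) ≤ n * η) (hN : N = n ^ 4)
    (hK : K = 8 * Real.sqrt (((d : ℝ) + 6) * Real.log N)) :
    0 < K ∧
    2 * (Λ * K) ^ 2 * Real.log (2 * ((d + 1) * N ^ (d + 1) : ℕ)) ≤ N * η ^ 2 ∧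
    2 * (Λ * (d * (2 * R / N) + K / N)) ≤ η ∧
    Λ * (4 * Real.exp (-(K ^ 2 / 8)) * Real.sqrt 2 ^ d) ≤ η := by
  have hn1 : (2 : ℝ) ≤ n := by exact_mod_cast (by omega : 2 ≤ n)
  have hn0 : (0 : ℝ) < n := by linarith
  have hd0 : (0 : ℝ) ≤ d := Nat.cast_nonneg d
  have hNr : (N : ℝ) = (n : ℝ) ^ 4 := by rw [hN]; push_cast; rfl
  have hnN : n ≤ N := hN ▸ Nat.le_self_pow (by norm_num) n
  have hnNr : (n : ℝ) ≤ N := by exact_mod_cast hnN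
  have hN0 : (0 : ℝ) < N := by linarith
  have hlogpos : 0 < Real.log N := Real.log_pos (by linarith)
  -- With `N = n ^ 4` this crude bound suffices: the squared logarithm costs `n ^ 2`, and `N * η ^ 2
  -- = n ^ 2 * (n * η) ^ 2` leaves `(n * η) ^ 2` for the constants.
  have hlogn : Real.log N ≤ 4 * n := by
    rw [hNr, Real.log_pow]
    have := Real.log_le_sub_one_of_pos hn0
    push_cast
    linarith
  have hprod : 0 < ((d : ℝ) + 6) * Real.log N := by positivity
  have hKsq : K ^ 2 = 64 * (((d : ℝ) + 6) * Real.log N) := by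
    rw [hK, mul_pow, Real.sq_sqrt hprod.le]; norm_num
  have hK0 : 0 < K := by rw [hK]; positivity
  have hKn : K ≤ 32 * (d + 6) * n := by
    have h1 : K ^ 2 ≤ 256 * ((d + 6) * n) := by
      rw [hKsq]
      nlinarith [mul_le_mul_of_nonneg_left hlogn (by linarith : (0 : ℝ) ≤ d + 6)]
    have h2 : (1 : ℝ) ≤ (d + 6) * n := by nlinarith
    refine le_of_sq_le_sq ?_ (by positivity)
    refine h1.trans ?_
    nlinarith [mul_le_mul_of_nonneg_left h2 (by linarith : (0 : ℝ) ≤ (d + 6) * n)]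
  refine ⟨hK0, ?_, ?_, ?_⟩
  · have hcard : (2 : ℝ) * ((d + 1) * N ^ (d + 1) : ℕ) ≤ (N : ℝ) ^ (d + 2) := by
      have : 2 * ((d + 1) * N ^ (d + 1)) ≤ N ^ (d + 2) := by
        rw [← mul_assoc, pow_succ' N (d + 1)]
        exact Nat.mul_le_mul_right _ (hn.trans hnN)
      exact_mod_cast this
    have hlogcard : Real.log (2 * ((d + 1) * N ^ (d + 1) : ℕ)) ≤ (d + 6) * Real.log N := by
      refine (Real.log_le_log ?_ hcard).trans ?_
      · push_cast; positivity
      · rw [Real.log_pow]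
        push_cast
        nlinarith
    have hsq : (((d : ℝ) + 6) * Real.log N) ^ 2 ≤ (((d : ℝ) + 6) * (4 * n)) ^ 2 := by gcongr
    calc 2 * (Λ * K) ^ 2 * Real.log (2 * ((d + 1) * N ^ (d + 1) : ℕ))
        ≤ 2 * (Λ * K) ^ 2 * ((d + 6) * Real.log N) := by gcongr
      _ = 128 * Λ ^ 2 * (((d : ℝ) + 6) * Real.log N) ^ 2 := by rw [mul_pow, hKsq]; ring
      _ ≤ 128 * Λ ^ 2 * (((d : ℝ) + 6) * (4 * n)) ^ 2 := by gcongr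
      _ = n ^ 2 * (2048 * (Λ * (d + 6)) ^ 2) := by ring
      _ ≤ n ^ 2 * (64 * (Λ * (d + 6))) ^ 2 := by
          gcongr
          nlinarith [sq_nonneg (Λ * (d + 6))]
      _ ≤ n ^ 2 * (n * η) ^ 2 := by
          have h1 : 64 * (Λ * (d + 6)) ≤ n * η := by
            refine le_trans ?_ hB
            have : 0 ≤ Λ * R * (d + 6) := by positivity
            nlinarith
          gcongr
      _ = N * η ^ 2 := by rw [hNr]; ring
  · have h1 : 2 * (Λ * (d * (2 * R / N) + K / N)) = 2 * Λ * (2 * R * d + K) / N := by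
      field_simp
    rw [h1, div_le_iff₀ hN0]
    calc 2 * Λ * (2 * R * d + K) ≤ 2 * Λ * (2 * R * (d + 6) * n + 32 * (d + 6) * n) := by
          refine mul_le_mul_of_nonneg_left ?_ (by positivity)
          have : 2 * R * (d : ℝ) ≤ 2 * R * (d + 6) := by nlinarith
          have : 2 * R * ((d : ℝ) + 6) * 1 ≤ 2 * R * (d + 6) * n :=
            mul_le_mul_of_nonneg_left (by linarith) (by positivity)
          linarith
      _ = (Λ * (4 * R + 64) * (d + 6)) * n := by ring
      _ ≤ n * η * n := by gcongr
      _ = η * n ^ 2 := by ring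
      _ ≤ η * N := by
          rw [hNr]
          gcongr
          · linarith
          · norm_num
  -- The tail factor is `N ^ (-8 * (d + 6))`, which absorbs `√2 ^ d ≤ N ^ d`.
  · have h2 : Real.sqrt 2 ^ d ≤ Real.exp (d * Real.log N) := by
      rw [Real.exp_nat_mul, Real.exp_log hN0]
      gcongr
      exact Real.sqrt_le_iff.2 ⟨by linarith, by nlinarith⟩
    have h3 : Real.exp (-(K ^ 2 / 8)) * Real.sqrt 2 ^ d ≤ 1 / n := by
      calc _ ≤ Real.exp (-(K ^ 2 / 8)) * Real.exp (d * Real.log N) := by gcongr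
        _ ≤ Real.exp (-Real.log N) := by
            rw [← Real.exp_add, Real.exp_le_exp, hKsq]
            nlinarith [mul_nonneg hd0 hlogpos.le]
        _ = 1 / N := by rw [Real.exp_neg, Real.exp_log hN0, one_div]
        _ ≤ 1 / n := by gcongr
    calc Λ * (4 * Real.exp (-(K ^ 2 / 8)) * Real.sqrt 2 ^ d)
        = 4 * Λ * (Real.exp (-(K ^ 2 / 8)) * Real.sqrt 2 ^ d) := by ring
      _ ≤ 4 * Λ * (1 / n) := by gcongr
      _ ≤ η := by
          rw [mul_one_div, div_le_iff₀ hn0]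
          have : 0 ≤ Λ * R * (d + 6) := by positivity
          have : 0 ≤ Λ * d := by positivity
          nlinarith

lemma EuclideanSpace.norm_le_of_abs_apply_le {d : ℕ}
    (v : EuclideanSpace ℝ (Fin d)) {ε : ℝ} (hε : 0 < ε) (h : ∀ i, |v i| ≤ ε / (d + 1)) :
    ‖v‖ ≤ ε := by
  refine (EuclideanSpace.norm_le_sum_abs v).trans ?_
  refine (Finset.sum_le_sum fun i _ => h i).trans ?_
  rw [Finset.sum_const, Finset.card_univ, Fintype.card_fin, nsmul_eq_mul, mul_div_assoc',
    div_le_iff₀ (by positivity)]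
  nlinarith

theorem mainTheorem4 :
    ∃ P : MvPolynomial (Fin 4) ℝ,
      ∀ (d : ℕ) (L : NNReal) (ε R : ℝ), 0 < ε → 0 < R →
        ∃ N : ℕ, 1 ≤ N ∧
          (N : ℝ) ≤ MvPolynomial.eval ![1 / ε, (d : ℝ), (L : ℝ), R] P ∧
          ∀ f : EuclideanSpace ℝ (Fin d) → ℝ,
            Differentiable ℝ f → LipschitzWith L f → LipschitzWith L (gradient f) →
            ∃ z : Fin N → EuclideanSpace ℝ (Fin d),
              (∀ n, ‖z n‖ ≤ 8 * Real.sqrt (((d : ℝ) + 6) * Real.log (N : ℝ))) ∧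
              ∀ x ∈ Metric.closedBall (0 : EuclideanSpace ℝ (Fin d)) R,
                ∀ t ∈ Set.Icc (0 : ℝ) 1,
                  Integrable (fun w => f (ouPoint t x w))
                    (stdGaussian (EuclideanSpace ℝ (Fin d))) ∧
                  DifferentiableAt ℝ (ouSemigroup t f) x ∧
                  |(1 / (N : ℝ)) * ∑ n, f (ouPoint t x (z n)) - ouSemigroup t f x| ≤ ε ∧
                  ‖(1 / (N : ℝ)) • ∑ n, gradient (fun y => f (ouPoint t y (z n))) x
                      - gradient (ouSemigroup t f) x‖ ≤ ε := by
  -- The fourth power of the quantity rounded up to `n`, plus 1 for the ceiling.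
  refine ⟨(2 * (.X 1 + 1) + 4 * (.X 1 + 1) * .X 0 * ((.X 2 + 1) * (4 * .X 3 + 64) * (.X 1 + 6))
    + 1) ^ 4, ?_⟩
  intro d L ε R hε hR
  obtain ⟨n, hn⟩ : ∃ n, n = ⌈2 * ((d : ℝ) + 1) + 4 * ((d : ℝ) + 1) * (1 / ε) *
      (((L : ℝ) + 1) * (4 * R + 64) * ((d : ℝ) + 6))⌉₊ := ⟨_, rfl⟩
  have hA := Nat.le_ceil (2 * ((d : ℝ) + 1) + 4 * ((d : ℝ) + 1) * (1 / ε) *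
      (((L : ℝ) + 1) * (4 * R + 64) * ((d : ℝ) + 6)))
  have hA' := Nat.ceil_lt_add_one (show 0 ≤ 2 * ((d : ℝ) + 1) + 4 * ((d : ℝ) + 1) * (1 / ε) *
      (((L : ℝ) + 1) * (4 * R + 64) * ((d : ℝ) + 6)) by positivity)
  rw [← hn] at hA hA'
  have hn2 : 2 * (d + 1) ≤ n := by
    have : (2 * ((d : ℝ) + 1)) ≤ n := le_trans (le_add_of_nonneg_right (by positivity)) hA
    exact_mod_cast this
  -- Sampling, grid and truncation errors cost at most `η` each; the factor `d + 1` pays for summing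
  -- the coordinates of the gradient.
  have hη : 0 < ε / (4 * (d + 1)) := by positivity
  have hB : ((L : ℝ) + 1) * (4 * R + 64) * (d + 6) ≤ n * (ε / (4 * (d + 1))) := by
    have : 4 * ((d : ℝ) + 1) * (1 / ε) * (((L : ℝ) + 1) * (4 * R + 64) * ((d : ℝ) + 6)) ≤ n :=
      le_trans (le_add_of_nonneg_left (by positivity)) hA
    calc ((L : ℝ) + 1) * (4 * R + 64) * (d + 6)
        = (4 * ((d : ℝ) + 1) * (1 / ε) * (((L : ℝ) + 1) * (4 * R + 64) * ((d : ℝ) + 6))) *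
          (ε / (4 * (d + 1))) := by field_simp
      _ ≤ _ := by gcongr
  obtain ⟨N, hN⟩ : ∃ N, N = n ^ 4 := ⟨_, rfl⟩
  obtain ⟨hK0, hlog, hnet, htail⟩ := sample_size_bounds (by simp : (1 : ℝ) ≤ (L : ℝ) + 1) hR hη
    hn2 hB hN rfl
  have hN1 : 1 ≤ N := hN ▸ Nat.one_le_pow _ _ (by omega)
  refine ⟨N, hN1, ?_, ?_⟩
  · rw [hN]
    simp only [Nat.cast_pow, map_pow, map_add, map_mul, map_one, map_ofNat, MvPolynomial.eval_X,
      Matrix.cons_val]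
    gcongr
  intro f hd hf hg
  -- `L + 1` replaces `L` because the sampling lemma needs a positive constant.
  have hle : L ≤ L + 1 := le_self_add
  let h : Option (Fin d) → EuclideanSpace ℝ (Fin d) → ℝ := fun o =>
    o.elim f fun i x => gradient f x i
  have hh : ∀ o, LipschitzWith (L + 1) (h o) := by
    rintro (_ | i)
    · exact hf.weaken hle
    · exact (hg.apply_euclideanSpace i).weaken hle
  obtain ⟨z, hzK, hz⟩ := exists_sample_uniform_gaussian_average (by positivity) hh hR hK0 hη hN1
    (by simpa using hlog)
  refine ⟨z, hzK, fun x hx t ht => ?_⟩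
  have hgrad := hasGradientAt_ouSemigroup hd hf hg t x
  have hexp : Real.exp (-t) ≤ 1 := Real.exp_le_one_iff.2 (by linarith [ht.1])
  have hy : ‖Real.exp (-t) • x‖ ≤ R := by
    rw [norm_smul, Real.norm_of_nonneg (Real.exp_pos _).le]
    exact (mul_le_of_le_one_left (norm_nonneg _) hexp).trans (mem_closedBall_zero_iff.1 hx)
  have hs : Real.sqrt (1 - Real.exp (-2 * t)) ∈ Set.Icc (0 : ℝ) 1 :=
    ⟨Real.sqrt_nonneg _, Real.sqrt_le_one.2 (by linarith [Real.exp_pos (-2 * t)])⟩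
  have hbound : ∀ o, |1 / (N : ℝ) * ∑ n, h o (ouPoint t x (z n)) -
      ∫ w, h o (ouPoint t x w) ∂(stdGaussian (EuclideanSpace ℝ (Fin d)))| ≤ ε / (d + 1) := by
    intro o
    refine (hz o _ hy _ hs).trans ?_
    have h1 := mul_le_mul_of_nonneg_left (integral_norm_sub_truncBall_le d hK0.le)
      (by positivity : (0 : ℝ) ≤ (L : ℝ) + 1)
    have h2 : ε / ((d : ℝ) + 1) = 4 * (ε / (4 * (d + 1))) := by field_simp
    rw [h2]
    push_cast
    linarith
  refine ⟨hf.integrable_comp_add_smul_stdGaussian _ _, hgrad.differentiableAt, ?_, ?_⟩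
  · refine (hbound none).trans (div_le_self hε.le ?_)
    have : (0 : ℝ) ≤ d := Nat.cast_nonneg d
    linarith
  · rw [hgrad.gradient]
    simp_rw [gradient_comp_ouPoint hd]
    rw [← Finset.smul_sum, smul_comm, ← smul_sub, norm_smul,
      Real.norm_of_nonneg (Real.exp_pos _).le]
    refine (mul_le_of_le_one_left (norm_nonneg _) hexp).trans ?_
    refine EuclideanSpace.norm_le_of_abs_apply_le _ hε fun i => ?_
    have hproj : (∫ w, gradient f (ouPoint t x w)
        ∂(stdGaussian (EuclideanSpace ℝ (Fin d)))) i =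
        ∫ w, gradient f (ouPoint t x w) i ∂(stdGaussian (EuclideanSpace ℝ (Fin d))) :=
      ((EuclideanSpace.proj i : EuclideanSpace ℝ (Fin d) →L[ℝ] ℝ).integral_comp_comm
        (hg.integrable_comp_add_smul_stdGaussian _ _)).symm
    have := hbound (some i)
    simp only [h, Option.elim_some] at this
    simpa [hproj] using this
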